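/- **Setting.** Let $W_0$ be a finite-dimensional real symplectic vector space with form $\langle\cdot,\cdot\rangle$, let $Sp=Sp(W_0)$, and let $\mathcal W$ be the complexified Weyl algebra of $W_0$: the complex algebra generated by $W=\mathbb C\otimes W_0$ with relations $w_1w_2-w_2w_1=\langle w_1,w_2\rangle$. There is a canonical Lie algebra homomorphism $\mathfrak{sp}(W_0)\to\mathcal W$, with image in the span of the elements $w_1w_2+w_2w_1$, under which $\operatorname{ad}$ induces the natural action of $\mathfrak{sp}(W_0)$ on $W$; explicitly $X\mapsto\frac12\sum_i (Xe_i)e^i$ for a basis $(e_i)$ of $W_0$ and the basis $(e^i)$ with $\langle e^i,e_j\rangle=\delta_{ij}$. Let $(G_0,G_0')$ be an irreducible reductive dual pair of real Lie groups in $Sp$: $G_0$ and $G_0'$ are each other's full centralizers in $Sp$, both act completely reducibly on $W_0$, and $W_0\neq0$ is not the orthogonal direct sum of two nonzero $G_0G_0'$-invariant subspaces. Let $\mathfrak g,\mathfrak g'$ be the complexified Lie algebras of $G_0,G_0'$ and let $R:U(\mathfrak g)\to\mathcal W$, $L:U(\mathfrak g')\to\mathcal W$ be the homomorphisms induced by the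 canonical one. For a subspace $I'\subseteq U(\mathfrak g')$ the *transfer* is $$\theta(I')=R^{-1}\bigl(L(I')\cdot\mathcal W\bigr)\subseteq U(\mathfrak g).$$ Choose a maximal compact subgroup $U$ of $Sp$, i.e. the centralizer in $Sp$ of a complex structure $J\in Sp$ of $W_0$ with $\langle v,Jv\rangle>0$ for $v\ne0$, such that the Cartan involution $g\mapsto JgJ^{-1}$ preserves $G_0$ and $G_0'$. Let $\widetilde U=\{(u,z)\in U\times\mathbb C^\times: z^2=\det_{\mathbb C}u\}$ be its metaplectic two-fold cover, and let $\widetilde K,\widetilde K'$ be the preimages in $\widetilde U$ of $K=G_0\cap U$, $K'=G_0'\cap U$; these are maximal compact subgroups of the metaplectic covers of $G_0$ and $G_0'$. Let $\omega$ be the space of $\widetilde U$-finite vectors of the oscillator representation (the Fock model): $\omega=\mathcal W/\mathcal W W^{-}$, where $W^-\subset W$ is the $(-i)$-eigenspace of $J$; $\mathcal W$ acts by left multiplication, $\mathfrak g$ and $\mathfrak g'$ act through $R$ and $L$, and $(u,z)\in\widetilde U$ acts by $z$ times the map induced by the automorphism $u$ of $\mathcal W$. Representations of the metaplectic covers are replaced,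 as usual, by their $(\mathfrak g,\widetilde K)$-modules and $(\mathfrak g',\widetilde K')$-modules of $\widetilde K$- and $\widetilde K'$-finite vectors. Irreducible admissible modules $\rho$ and $\rho'$ *correspond under real Howe duality* if $\omega$ has a subspace $\omega_0$, invariant under $\mathfrak g$, $\widetilde K$, $\mathfrak g'$, $\widetilde K'$, such that $\omega/\omega_0\cong\rho\otimes\rho'$ as a $(\mathfrak g,\widetilde K)$- and $(\mathfrak g',\widetilde K')$-module. **Theorem.** Let $\rho$ and $\rho'$ be irreducible admissible representations of the metaplectic covers of $G_0$ and $G_0'$ that correspond to each other under real Howe duality, and let $I\subseteq U(\mathfrak g)$ and $I'\subseteq U(\mathfrak g')$ be their annihilators. Then $\theta(I')\subseteq I$. -/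

import Mathlib

open scoped TensorProduct

noncomputable section

namespace HoweDuality

attribute [local instance 100] LieRing.ofAssociativeRing

/-! ### Weyl algebras -/

section Weyl

variable {K V : Type*} [Field K] [AddCommGroup V] [Module K V]

/-- The relations `v w = w v + ⟨v, w⟩` on the tensor algebra of `V`. -/
inductive WeylRel (B : LinearMap.BilinForm K V) : TensorAlgebra K V → TensorAlgebra K V → Prop
  | comm (v w : V) : WeylRel B (TensorAlgebra.ι K v * TensorAlgebra.ι K w)
      (TensorAlgebra.ι K w * TensorAlgebra.ι K v + algebraMap K _ (B v w))

/-- The Weyl algebra of `(V, B)`: generated by `V` subject to `v w - w v = B v w`. -/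
def WeylAlgebra (B : LinearMap.BilinForm K V) : Type _ := RingQuot (WeylRel B)

instance (B : LinearMap.BilinForm K V) : Ring (WeylAlgebra B) :=
  inferInstanceAs (Ring (RingQuot (WeylRel B)))

instance (B : LinearMap.BilinForm K V) : Algebra K (WeylAlgebra B) :=
  inferInstanceAs (Algebra K (RingQuot (WeylRel B)))

/-- The canonical map of `V` into its Weyl algebra. -/
def WeylAlgebra.ι (B : LinearMap.BilinForm K V) : V →ₗ[K] WeylAlgebra B :=
  (RingQuot.mkAlgHom K (WeylRel B)).toLinearMap ∘ₗ TensorAlgebra.ι K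

theorem WeylAlgebra.ι_mul_ι (B : LinearMap.BilinForm K V) (v w : V) :
    ι B v * ι B w = ι B w * ι B v + algebraMap K (WeylAlgebra B) (B v w) := by
  have h := RingQuot.mkAlgHom_rel K (WeylRel.comm (B := B) v w)
  rw [map_mul, map_add, map_mul, AlgHom.commutes] at h
  exact h

/-- The universal property of the Weyl algebra. -/
def WeylAlgebra.lift (B : LinearMap.BilinForm K V) {A : Type*} [Ring A] [Algebra K A]
    (f : V →ₗ[K] A) (hf : ∀ v w, f v * f w = f w * f v + algebraMap K A (B v w)) :
    WeylAlgebra B →ₐ[K] A :=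
  RingQuot.liftAlgHom K ⟨TensorAlgebra.lift K f, by
    rintro _ _ ⟨v, w⟩
    simpa using hf v w⟩

@[simp]
theorem WeylAlgebra.lift_ι (B : LinearMap.BilinForm K V) {A : Type*} [Ring A] [Algebra K A]
    (f : V →ₗ[K] A) (hf : ∀ v w, f v * f w = f w * f v + algebraMap K A (B v w)) (v : V) :
    lift B f hf (ι B v) = f v := by
  unfold lift ι
  erw [LinearMap.comp_apply, AlgHom.toLinearMap_apply, RingQuot.liftAlgHom_mkAlgHom_apply]
  simp

theorem WeylAlgebra.hom_ext (B : LinearMap.BilinForm K V) {A : Type*} [Ring A] [Algebra K A]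
    {f g : WeylAlgebra B →ₐ[K] A} (h : ∀ v, f (ι B v) = g (ι B v)) : f = g := by
  apply RingQuot.ringQuot_ext'
  ext v
  exact h v

end Weyl

/-! ### Transfer -/

/-- The transfer `θ(I') = R⁻¹(L(I') · 𝒲)` of a subspace `I'` along `L : U' → 𝒲` and
`R : U → 𝒲`; here `L(I') · 𝒲`, the span of the products, is the right ideal generated
by `L(I')`. -/
def transfer {K U U' A : Type*} [CommSemiring K] [Semiring U] [Semiring U'] [Semiring A]
    [Algebra K U] [Algebra K U'] [Algebra K A] (L : U' →ₐ[K] A) (R : U →ₐ[K] A)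
    (I' : Submodule K U') : Submodule K U :=
  (I'.map L.toLinearMap * (⊤ : Submodule K A)).comap R.toLinearMap

/-- Extension of a homomorphism of real Lie algebras `𝔤₀ → A`, with `A` a complex associative
algebra, to the complexification `ℂ ⊗ 𝔤₀`. -/
def complexify {L A : Type*} [LieRing L] [LieAlgebra ℝ L] [Ring A] [Algebra ℂ A]
    (f : L →ₗ⁅ℝ⁆ A) : ℂ ⊗[ℝ] L →ₗ⁅ℂ⁆ A where
  toLinearMap := TensorProduct.AlgebraTensorModule.lift
    ((LinearMap.toSpanSingleton ℂ (L →ₗ[ℝ] A) (f : L →ₗ[ℝ] A)))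
  map_lie' := by
    intro x y
    induction x using TensorProduct.induction_on with
    | zero => simp
    | add x₁ x₂ h₁ h₂ => simp_all [add_lie]
    | tmul a x =>
      induction y using TensorProduct.induction_on with
      | zero => simp
      | add y₁ y₂ h₁ h₂ => simp_all [lie_add]
      | tmul b y =>
        simp [LieAlgebra.ExtendScalars.bracket_tmul, LieRing.of_associative_ring_bracket, smul_sub,
          smul_smul, mul_comm]

/-! ### Real symplectic spaces, the symplectic group and its Lie algebra

The norm on the finite-dimensional real space `W` only serves to topologize `W` and the algebra
of its endomorphisms. -/

section Symplectic

variable {W : Type*} [NormedAddCommGroup W] [NormedSpace ℝ W]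

variable (W) in
/-- A symplectic form on `W`. -/
structure SymplecticForm where
  form : LinearMap.BilinForm ℝ W
  isAlt : form.IsAlt
  nondegenerate : form.Nondegenerate

/-- The symplectic group `Sp(W)`. -/
def Sp (S : SymplecticForm W) : Subgroup (W →L[ℝ] W)ˣ where
  carrier := {g | ∀ v w, S.form (g.1 v) (g.1 w) = S.form v w}
  mul_mem' := by
    intro a b ha hb v w
    simp only [Units.val_mul, mul_apply_eq_comp]
    rw [ha, hb]
  one_mem' := by intro v w; simp
  inv_mem' := by
    intro a ha v w
    have h : ∀ x, a.1 (a⁻¹.1 x) = x := fun x => by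
      rw [← mul_apply_eq_comp, Units.mul_inv]; rfl
    rw [← ha, h, h]

/-- The symplectic Lie algebra `𝔰𝔭(W)`. -/
def sp (S : SymplecticForm W) : LieSubalgebra ℝ (W →L[ℝ] W) where
  carrier := {X | ∀ v w, S.form (X v) w + S.form v (X w) = 0}
  add_mem' := by
    intro X Y hX hY v w
    simp only [add_apply, map_add, LinearMap.add_apply]
    linear_combination hX v w + hY v w
  zero_mem' := by intro v w; simp
  smul_mem' := by
    intro c X hX v w
    simp only [smul_apply, map_smul, LinearMap.smul_apply, smul_eq_mul]
    linear_combination c * hX v w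
  lie_mem' := by
    intro X Y hX hY v w
    simp only [LieRing.of_associative_ring_bracket, sub_apply,
      mul_apply_eq_comp, map_sub, LinearMap.sub_apply]
    linear_combination hX (Y v) w - hY v (X w) - hY (X v) w + hX v (Y w)

/-- The Lie algebra of a closed subgroup `G` of `Sp(W)`, as a subalgebra of `𝔰𝔭(W)`: it consists
of the `X` with `exp (t X) ∈ G` for all real `t`. (For closed `G` these `X` already form a Lie
algebra, so that `lieSpan` adds nothing.) -/
def lieAlg (S : SymplecticForm W) (G : Subgroup (W →L[ℝ] W)ˣ) : LieSubalgebra ℝ (sp S) :=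
  LieSubalgebra.lieSpan ℝ (sp S)
    {X | ∀ t : ℝ, ∃ g ∈ G, (g : W →L[ℝ] W) = NormedSpace.exp (t • (X : W →L[ℝ] W))}

/-- The complexified Lie algebra `𝔤` of `G`. -/
abbrev cLieAlg (S : SymplecticForm W) (G : Subgroup (W →L[ℝ] W)ˣ) : Type _ :=
  ℂ ⊗[ℝ] lieAlg S G

/-- The complexified Weyl algebra `𝒲` of `W`. -/
abbrev CWeyl (S : SymplecticForm W) : Type _ := WeylAlgebra (S.form.baseChange ℂ)

/-- The inclusion of the real space `W` into `𝒲`. -/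
def inW (S : SymplecticForm W) : W →ₗ[ℝ] CWeyl S :=
  ((WeylAlgebra.ι (S.form.baseChange ℂ)).restrictScalars ℝ) ∘ₗ TensorProduct.mk ℝ ℂ W 1

theorem inW_mul_inW (S : SymplecticForm W) (v w : W) :
    inW S v * inW S w = inW S w * inW S v + S.form v w • (1 : CWeyl S) := by
  have h := WeylAlgebra.ι_mul_ι (S.form.baseChange ℂ) (1 ⊗ₜ[ℝ] v) (1 ⊗ₜ[ℝ] w)
  rw [LinearMap.BilinForm.baseChange_tmul, mul_one, Algebra.algebraMap_eq_smul_one,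
    smul_assoc, one_smul] at h
  exact h

section FiniteDim

variable [FiniteDimensional ℝ W]

/-- The `S`-dual of the basis `e` of `W`: `⟨eⁱ, eⱼ⟩ = δᵢⱼ`. -/
abbrev dualB (S : SymplecticForm W) :
    Module.Basis (Fin (Module.finrank ℝ W)) ℝ W :=
  S.form.dualBasis S.nondegenerate (Module.finBasis ℝ W)

theorem sum_dualB (S : SymplecticForm W) (u : W) :
    ∑ i, S.form u (Module.finBasis ℝ W i) • dualB S i = u := by
  conv_rhs => rw [← (dualB S).sum_repr u]
  simp only [LinearMap.BilinForm.dualBasis_repr_apply]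

theorem sum_finBasis (S : SymplecticForm W) (u : W) :
    ∑ i, S.form (dualB S i) u • Module.finBasis ℝ W i = u := by
  conv_rhs => rw [← (Module.finBasis ℝ W).sum_repr u]
  refine Finset.sum_congr rfl fun i _ => ?_
  congr 1
  conv_lhs => rw [← (Module.finBasis ℝ W).sum_repr u]
  rw [map_sum]
  simp_rw [map_smul, LinearMap.BilinForm.apply_dualBasis_left]
  simp

/-- The canonical linear map `𝔰𝔭(W) → 𝒲²`, `X ↦ ½ ∑ᵢ (X eᵢ) eⁱ`. -/
def quadLin (S : SymplecticForm W) : sp S →ₗ[ℝ] CWeyl S where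
  toFun X := (1 / 2 : ℝ) • ∑ i, inW S ((X : W →L[ℝ] W) (Module.finBasis ℝ W i)) * inW S (dualB S i)
  map_add' X Y := by simp [add_mul, Finset.sum_add_distrib]
  map_smul' c X := by simp [Finset.smul_sum, smul_comm c]

/-- The adjoint action of `quadLin S X` on `W ⊆ 𝒲` is the natural action of `X`. -/
theorem quadLin_comm (S : SymplecticForm W) (X : sp S) (w : W) :
    quadLin S X * inW S w - inW S w * quadLin S X = inW S ((X : W →L[ℝ] W) w) := by
  have key : ∀ i, inW S ((X : W →L[ℝ] W) (Module.finBasis ℝ W i)) * inW S (dualB S i) * inW S w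
      - inW S w * (inW S ((X : W →L[ℝ] W) (Module.finBasis ℝ W i)) * inW S (dualB S i))
      = S.form (dualB S i) w • inW S ((X : W →L[ℝ] W) (Module.finBasis ℝ W i))
        + S.form ((X : W →L[ℝ] W) w) (Module.finBasis ℝ W i) • inW S (dualB S i) := by
    intro i
    have h1 := inW_mul_inW S (dualB S i) w
    have h2 := inW_mul_inW S ((X : W →L[ℝ] W) (Module.finBasis ℝ W i)) w
    have h3 : S.form ((X : W →L[ℝ] W) (Module.finBasis ℝ W i)) w
        = S.form ((X : W →L[ℝ] W) w) (Module.finBasis ℝ W i) := by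
      have := X.2 (Module.finBasis ℝ W i) w
      have h4 := LinearMap.IsAlt.neg S.isAlt ((X : W →L[ℝ] W) w) (Module.finBasis ℝ W i)
      linarith
    rw [mul_assoc, h1, mul_add, ← mul_assoc, h2, h3]
    simp [add_mul, mul_assoc]
    abel
  have e1 : inW S ((X : W →L[ℝ] W) w)
      = ∑ i, S.form (dualB S i) w • inW S ((X : W →L[ℝ] W) (Module.finBasis ℝ W i)) := by
    conv_lhs => rw [← sum_finBasis S w]
    simp
  have e2 : inW S ((X : W →L[ℝ] W) w)
      = ∑ i, S.form ((X : W →L[ℝ] W) w) (Module.finBasis ℝ W i) • inW S (dualB S i) := by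
    conv_lhs => rw [← sum_dualB S ((X : W →L[ℝ] W) w)]
    simp
  have : quadLin S X * inW S w - inW S w * quadLin S X
      = (1 / 2 : ℝ) • (inW S ((X : W →L[ℝ] W) w) + inW S ((X : W →L[ℝ] W) w)) := by
    conv_rhs => enter [2]; rw [e1]
    conv_rhs => enter [2, 2]; rw [← e1, e2]
    rw [← Finset.sum_add_distrib]
    simp only [← key]
    simp [quadLin, Finset.sum_mul, Finset.mul_sum, smul_sub]
  rw [this, ← two_smul ℝ, smul_smul]
  norm_num

/-- The canonical Lie algebra homomorphism `𝔰𝔭(W) ≃ 𝒲² ⊆ 𝒲`. -/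
def quad (S : SymplecticForm W) : sp S →ₗ⁅ℝ⁆ CWeyl S where
  toLinearMap := quadLin S
  map_lie' := by
    intro X Y
    have hY : ∀ Y : sp S, quadLin S Y = (1 / 2 : ℝ) • ∑ i,
      inW S ((Y : W →L[ℝ] W) (Module.finBasis ℝ W i)) * inW S (dualB S i) := fun _ => rfl
    have key : ∀ i, quadLin S X * (inW S ((Y : W →L[ℝ] W) (Module.finBasis ℝ W i))
          * inW S (dualB S i))
        - inW S ((Y : W →L[ℝ] W) (Module.finBasis ℝ W i)) * inW S (dualB S i) * quadLin S X
        = inW S ((X : W →L[ℝ] W) ((Y : W →L[ℝ] W) (Module.finBasis ℝ W i))) * inW S (dualB S i)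
          + inW S ((Y : W →L[ℝ] W) (Module.finBasis ℝ W i))
            * inW S ((X : W →L[ℝ] W) (dualB S i)) := by
      intro i
      rw [← quadLin_comm S X, ← quadLin_comm S X]
      noncomm_ring
    have swap : ∑ i, inW S ((Y : W →L[ℝ] W) (Module.finBasis ℝ W i))
          * inW S ((X : W →L[ℝ] W) (dualB S i))
        = - ∑ i, inW S ((Y : W →L[ℝ] W) ((X : W →L[ℝ] W) (Module.finBasis ℝ W i)))
            * inW S (dualB S i) := by
      have a1 : ∀ i, inW S ((X : W →L[ℝ] W) (dualB S i))
          = ∑ k, S.form ((X : W →L[ℝ] W) (dualB S i)) (Module.finBasis ℝ W k)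
              • inW S (dualB S k) := by
        intro i
        conv_lhs => rw [← sum_dualB S ((X : W →L[ℝ] W) (dualB S i))]
        simp
      have a2 : ∀ k, inW S ((Y : W →L[ℝ] W) ((X : W →L[ℝ] W) (Module.finBasis ℝ W k)))
          = ∑ i, S.form (dualB S i) ((X : W →L[ℝ] W) (Module.finBasis ℝ W k))
              • inW S ((Y : W →L[ℝ] W) (Module.finBasis ℝ W i)) := by
        intro k
        conv_lhs => rw [← sum_finBasis S ((X : W →L[ℝ] W) (Module.finBasis ℝ W k))]
        simp
      simp only [a1, a2, Finset.mul_sum, Finset.sum_mul]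
      rw [Finset.sum_comm, ← Finset.sum_neg_distrib]
      refine Finset.sum_congr rfl fun k _ => ?_
      rw [← Finset.sum_neg_distrib]
      refine Finset.sum_congr rfl fun i _ => ?_
      have := X.2 (dualB S i) (Module.finBasis ℝ W k)
      rw [eq_neg_of_add_eq_zero_left this]
      simp
    change quadLin S ⁅X, Y⁆ = ⁅quadLin S X, quadLin S Y⁆
    rw [LieRing.of_associative_ring_bracket]
    conv_rhs => rw [hY Y]
    rw [mul_smul_comm, smul_mul_assoc, ← smul_sub, Finset.mul_sum, Finset.sum_mul,
      ← Finset.sum_sub_distrib]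
    simp only [key]
    rw [Finset.sum_add_distrib, swap, hY, ← sub_eq_add_neg, ← Finset.sum_sub_distrib]
    congr 1
    refine Finset.sum_congr rfl fun i _ => ?_
    rw [← sub_mul, ← map_sub]
    rfl

/-- The canonical homomorphism `U(𝔤) → 𝒲` for a subgroup `G` of `Sp(W)`; it is called `R` for the
member `G`, and `L` for the member `G'`, of a dual pair. -/
def toWeyl (S : SymplecticForm W) (G : Subgroup (W →L[ℝ] W)ˣ) :
    UniversalEnvelopingAlgebra ℂ (cLieAlg S G) →ₐ[ℂ] CWeyl S :=
  UniversalEnvelopingAlgebra.lift ℂ (complexify ((quad S).comp (lieAlg S G).incl))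

end FiniteDim

/-! ### Reductive dual pairs of real Lie groups -/

/-- `H` acts completely reducibly on `W`. -/
def ActsReductively (H : Subgroup (W →L[ℝ] W)ˣ) : Prop :=
  ∀ P : Submodule ℝ W, (∀ g ∈ H, ∀ v ∈ P, g.1 v ∈ P) →
    ∃ Q : Submodule ℝ W, (∀ g ∈ H, ∀ v ∈ Q, g.1 v ∈ Q) ∧ IsCompl P Q

/-- `(G, G')` is an irreducible reductive dual pair in `Sp(W)`: the two groups are each other's
full centralizers in `Sp(W)`, act completely reducibly on `W`, and `W ≠ 0` is not the orthogonal
sum of two nonzero `G G'`-invariant subspaces. -/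
structure IsIrreducibleDualPair (S : SymplecticForm W) (G G' : Subgroup (W →L[ℝ] W)ˣ) :
    Prop where
  eq_centralizer : G = Sp S ⊓ Subgroup.centralizer (G' : Set (W →L[ℝ] W)ˣ)
  eq_centralizer' : G' = Sp S ⊓ Subgroup.centralizer (G : Set (W →L[ℝ] W)ˣ)
  reductive : ActsReductively G
  reductive' : ActsReductively G'
  nontrivial : Nontrivial W
  irreducible : ∀ P : Submodule ℝ W, (∀ g ∈ G, ∀ v ∈ P, g.1 v ∈ P) →
    (∀ g ∈ G', ∀ v ∈ P, g.1 v ∈ P) → IsCompl P (S.form.orthogonal P) → P = ⊥ ∨ P = ⊤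

/-! ### Maximal compact subgroups and their metaplectic covers -/

/-- A positive compatible complex structure `J` on `W`. Such `J` correspond to the maximal compact
subgroups of `Sp(W)`: to `J` belongs the centralizer `U` of `J` in `Sp(W)`, which is the unitary
group of the complex space `(W, J)` with the Hermitian form whose real part is `⟨v, J w⟩`. -/
structure ComplexStructure (S : SymplecticForm W) where
  J : (W →L[ℝ] W)ˣ
  mul_self : J.1 * J.1 = -1
  mem_Sp : J ∈ Sp S
  pos : ∀ v, v ≠ 0 → 0 < S.form v (J.1 v)

variable {S : SymplecticForm W}

/-- The Cartan involution `g ↦ J g J⁻¹` of `Sp(W)` attached to `U` maps `G` to itself (and hence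
induces a Cartan involution of `G` if `G` is a member of a reductive dual pair). -/
def ComplexStructure.CartanStable (C : ComplexStructure S) (G : Subgroup (W →L[ℝ] W)ˣ) : Prop :=
  ∀ g ∈ G, C.J * g * C.J⁻¹ ∈ G

/-- The maximal compact subgroup `U` of `Sp(W)`. -/
def ComplexStructure.U (C : ComplexStructure S) : Subgroup (W →L[ℝ] W)ˣ :=
  Sp S ⊓ Subgroup.centralizer {C.J}

/-- The real space `W` regarded as a complex vector space through `J`. -/
def ComplexStructure.Cx (_C : ComplexStructure S) : Type _ := W

instance (C : ComplexStructure S) : AddCommGroup C.Cx := inferInstanceAs (AddCommGroup W)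

instance (C : ComplexStructure S) : Module ℂ C.Cx :=
  Module.compHom W (Complex.liftAux C.J.1 C.mul_self).toRingHom

theorem ComplexStructure.smul_def (C : ComplexStructure S) (z : ℂ) (v : W) :
    Complex.liftAux C.J.1 C.mul_self z v = z.re • v + z.im • C.J.1 v := by
  simp [Complex.liftAux_apply, Algebra.algebraMap_eq_smul_one]

theorem ComplexStructure.U_comm (C : ComplexStructure S) (u : C.U) (v : W) :
    u.1.1 (C.J.1 v) = C.J.1 (u.1.1 v) := by
  have h := Subgroup.mem_centralizer_iff.1 u.2.2 C.J rfl
  have h2 := congrArg (fun g : (W →L[ℝ] W)ˣ => g.1 v) h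
  simpa using h2.symm

theorem ComplexStructure.U_comm_smul (C : ComplexStructure S) (u : C.U) (z : ℂ) (v : W) :
    u.1.1 (Complex.liftAux C.J.1 C.mul_self z v) =
      Complex.liftAux C.J.1 C.mul_self z (u.1.1 v) := by
  rw [smul_def, smul_def, map_add, map_smul, map_smul, U_comm]

/-- An element of `U` as a complex linear map of `(W, J)`. -/
def ComplexStructure.toCx (C : ComplexStructure S) (u : C.U) : C.Cx →ₗ[ℂ] C.Cx where
  toFun v := u.1.1 v
  map_add' v w := map_add u.1.1 v w
  map_smul' z v := C.U_comm_smul u z v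

/-- The complex determinant on the unitary group `U`. -/
def ComplexStructure.cdet (C : ComplexStructure S) : C.U →* ℂ where
  toFun u := LinearMap.det (C.toCx u)
  map_one' := by
    have : C.toCx 1 = LinearMap.id := rfl
    rw [this, LinearMap.det_id]
  map_mul' u v := by
    have : C.toCx (u * v) = C.toCx u ∘ₗ C.toCx v := rfl
    rw [this, LinearMap.det_comp]

/-- The restriction of the metaplectic two-fold cover of `Sp(W)` to the maximal compact subgroup
`U`: the cover of `U` on which the complex determinant has a square root, realized as
`{(u, z) : z² = det u}`. -/
def ComplexStructure.MpU (C : ComplexStructure S) : Subgroup ((W →L[ℝ] W)ˣ × ℂˣ) where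
  carrier := {p | ∃ h : p.1 ∈ C.U, (p.2 : ℂ) ^ 2 = C.cdet ⟨p.1, h⟩}
  mul_mem' := by
    rintro p q ⟨hp, ep⟩ ⟨hq, eq⟩
    refine ⟨mul_mem hp hq, ?_⟩
    have : (⟨(p * q).1, mul_mem hp hq⟩ : C.U) = ⟨p.1, hp⟩ * ⟨q.1, hq⟩ := rfl
    rw [this, map_mul, ← ep, ← eq]
    simp [mul_pow]
  one_mem' := ⟨one_mem _, by
    have : (⟨(1 : (W →L[ℝ] W)ˣ × ℂˣ).1, one_mem _⟩ : C.U) = 1 := rfl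
    rw [this, map_one]; simp⟩
  inv_mem' := by
    rintro p ⟨hp, ep⟩
    refine ⟨inv_mem hp, ?_⟩
    have h1 : (⟨p⁻¹.1, inv_mem hp⟩ : C.U) * ⟨p.1, hp⟩ = 1 := Subtype.ext (inv_mul_cancel p.1)
    have h2 := congrArg C.cdet h1
    rw [map_mul, map_one, ← ep] at h2
    rw [eq_comm, ← mul_left_inj' (pow_ne_zero 2 p.2.ne_zero), h2]
    simp

/-- The maximal compact subgroup `K̃` of the metaplectic cover `G̃` of `G ⊆ Sp(W)`: the preimage of
`K = G ∩ U`. It carries the topology induced from `GL(W) × ℂˣ`. -/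
def ComplexStructure.Ktilde (C : ComplexStructure S) (G : Subgroup (W →L[ℝ] W)ˣ) :
    Subgroup ((W →L[ℝ] W)ˣ × ℂˣ) :=
  C.MpU ⊓ G.comap (MonoidHom.fst _ _)

/-! ### The oscillator representation -/

/-- The left ideal of `𝒲` generated by the `-i`-eigenspace `{x + i J x}` of `J` in `ℂ ⊗ W`. -/
def ComplexStructure.vacuumIdeal (C : ComplexStructure S) : Submodule (CWeyl S) (CWeyl S) :=
  Submodule.span (CWeyl S) (Set.range fun x : W => inW S x + Complex.I • inW S (C.J.1 x))

/-- The space of `Ũ`-finite vectors of the oscillator representation (the Fock model), as a module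
over the Weyl algebra: it is generated by a vacuum vector, the class of `1`, that is annihilated
by the `-i`-eigenspace of `J`; as a vector space it is the polynomial algebra on the
`i`-eigenspace. -/
abbrev ComplexStructure.Fock (C : ComplexStructure S) : Type _ := CWeyl S ⧸ C.vacuumIdeal

/-- The action of `Sp(W)` on `𝒲` by automorphisms. -/
def weylAct (S : SymplecticForm W) (g : Sp S) : CWeyl S →ₐ[ℂ] CWeyl S :=
  WeylAlgebra.lift (S.form.baseChange ℂ)
    (WeylAlgebra.ι (S.form.baseChange ℂ) ∘ₗ (g.1.1 : W →ₗ[ℝ] W).baseChange ℂ) (by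
      have key : ∀ v w : ℂ ⊗[ℝ] W, S.form.baseChange ℂ ((g.1.1 : W →ₗ[ℝ] W).baseChange ℂ v)
          ((g.1.1 : W →ₗ[ℝ] W).baseChange ℂ w) = S.form.baseChange ℂ v w := by
        intro v w
        induction v using TensorProduct.induction_on with
        | zero => simp
        | add x₁ x₂ h₁ h₂ => simp only [map_add, LinearMap.add_apply, h₁, h₂]
        | tmul a x =>
          induction w using TensorProduct.induction_on with
          | zero => simp
          | add y₁ y₂ h₁ h₂ => simp only [map_add, h₁, h₂]
          | tmul b y =>
            simp only [LinearMap.baseChange_tmul, LinearMap.BilinForm.baseChange_tmul]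
            congr 1
            exact g.2 x y
      intro v w
      rw [LinearMap.comp_apply, LinearMap.comp_apply, WeylAlgebra.ι_mul_ι, key])

theorem weylAct_inW (g : Sp S) (x : W) : weylAct S g (inW S x) = inW S (g.1.1 x) := by
  simp [weylAct, inW]

theorem weylAct_one : weylAct S 1 = AlgHom.id ℂ _ := by
  apply WeylAlgebra.hom_ext
  intro v
  simp [weylAct]

theorem weylAct_mul (g h : Sp S) : weylAct S (g * h) = (weylAct S g).comp (weylAct S h) := by
  apply WeylAlgebra.hom_ext
  intro v
  have : (((g * h : Sp S).1.1 : W →L[ℝ] W) : W →ₗ[ℝ] W).baseChange ℂ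
      = (g.1.1 : W →ₗ[ℝ] W).baseChange ℂ ∘ₗ (h.1.1 : W →ₗ[ℝ] W).baseChange ℂ :=
    LinearMap.baseChange_comp _ _
  simp only [weylAct, AlgHom.comp_apply, WeylAlgebra.lift_ι, LinearMap.comp_apply]
  rw [this, LinearMap.comp_apply]

theorem ComplexStructure.vacuumIdeal_stable (C : ComplexStructure S) (u : C.U) (a : CWeyl S)
    (ha : a ∈ C.vacuumIdeal) : weylAct S ⟨u.1, u.2.1⟩ a ∈ C.vacuumIdeal := by
  induction ha using Submodule.span_induction with
  | mem a h =>
    obtain ⟨x, rfl⟩ := h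
    refine Submodule.subset_span ⟨u.1.1 x, ?_⟩
    simp [weylAct_inW, C.U_comm]
  | zero => simp
  | add a b _ _ ha hb => rw [map_add]; exact add_mem ha hb
  | smul a b _ hb => rw [smul_eq_mul, map_mul]; exact Submodule.smul_mem _ _ hb

/-- The action of `U` on the Fock space induced by its action on `𝒲`; it fixes the vacuum. -/
def ComplexStructure.fockU (C : ComplexStructure S) (u : C.U) : C.Fock →ₗ[ℂ] C.Fock :=
  (Submodule.Quotient.restrictScalarsEquiv ℂ C.vacuumIdeal).toLinearMap ∘ₗ
    Submodule.mapQ (C.vacuumIdeal.restrictScalars ℂ) (C.vacuumIdeal.restrictScalars ℂ)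
      (weylAct S ⟨u.1, u.2.1⟩).toLinearMap (fun a ha => C.vacuumIdeal_stable u a ha) ∘ₗ
    (Submodule.Quotient.restrictScalarsEquiv ℂ C.vacuumIdeal).symm.toLinearMap

theorem ComplexStructure.fockU_mk (C : ComplexStructure S) (u : C.U) (a : CWeyl S) :
    C.fockU u (Submodule.Quotient.mk a) = Submodule.Quotient.mk (weylAct S ⟨u.1, u.2.1⟩ a) := rfl

theorem ComplexStructure.fockU_one (C : ComplexStructure S) : C.fockU 1 = LinearMap.id := by
  refine LinearMap.ext fun m => ?_
  obtain ⟨a, rfl⟩ := Submodule.Quotient.mk_surjective _ m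
  rw [fockU_mk]
  have : (⟨(1 : C.U).1, (1 : C.U).2.1⟩ : Sp S) = 1 := rfl
  rw [this, weylAct_one]
  rfl

theorem ComplexStructure.fockU_mul (C : ComplexStructure S) (u v : C.U) :
    C.fockU (u * v) = C.fockU u ∘ₗ C.fockU v := by
  refine LinearMap.ext fun m => ?_
  obtain ⟨a, rfl⟩ := Submodule.Quotient.mk_surjective _ m
  rw [LinearMap.comp_apply, fockU_mk, fockU_mk, fockU_mk]
  have : (⟨(u * v).1, (u * v).2.1⟩ : Sp S) = ⟨u.1, u.2.1⟩ * ⟨v.1, v.2.1⟩ := rfl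
  rw [this, weylAct_mul]
  rfl

/-- The covering map `Ũ → U`. -/
def ComplexStructure.MpU.proj (C : ComplexStructure S) : C.MpU →* C.U where
  toFun p := ⟨p.1.1, p.2.1⟩
  map_one' := rfl
  map_mul' _ _ := rfl

/-- The action of the metaplectic cover `Ũ` of `U` on the oscillator representation: `(u, z)` acts
by `z` times the action of `u`, so the vacuum has weight `det^{1/2}`. -/
def ComplexStructure.fockRep (C : ComplexStructure S) : Representation ℂ C.MpU C.Fock where
  toFun p := (p.1.2 : ℂ) • C.fockU (MpU.proj C p)
  map_one' := by
    rw [map_one, fockU_one]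
    exact one_smul ℂ _
  map_mul' p q := by
    rw [map_mul, fockU_mul, Module.End.mul_eq_comp, LinearMap.smul_comp, LinearMap.comp_smul,
      smul_smul]
    rfl

/-! ### Harish-Chandra modules -/

/-- A `(𝔤, K̃)`-module on the complex vector space `V`, for the metaplectic cover `G̃` of `G`. -/
structure GKModule (C : ComplexStructure S) (G : Subgroup (W →L[ℝ] W)ˣ)
    (V : Type*) [AddCommGroup V] [Module ℂ V] where
  /-- the action of `𝔤` -/
  lie : cLieAlg S G →ₗ⁅ℂ⁆ Module.End ℂ V
  /-- the action of `K̃` -/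
  rep : Representation ℂ (C.Ktilde G) V
  /-- every vector is `K̃`-finite -/
  finite : ∀ v : V, FiniteDimensional ℂ (Submodule.span ℂ (Set.range fun k => rep k v))
  /-- the action of `K̃` on the finite-dimensional invariant subspaces is continuous -/
  continuous : ∀ (v : V) (f : Module.Dual ℂ V), Continuous fun k => f (rep k v)
  /-- the differential of the action of `K̃` is the action of the Lie algebra of `K`; here `γ` is the
  lift to `K̃` of the one-parameter subgroup `exp (t X)` of `K` -/
  differential : ∀ (X : lieAlg S G) (γ : ℝ → C.Ktilde G), Continuous γ → γ 0 = 1 →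
    (∀ t, ((γ t).1.1 : W →L[ℝ] W) = NormedSpace.exp (t • (X.1.1 : W →L[ℝ] W))) →
    ∀ (v : V) (f : Module.Dual ℂ V),
      HasDerivAt (fun t => f (rep (γ t) v)) (f (lie (1 ⊗ₜ X) v)) 0
  /-- the actions of `K̃` and `𝔤` are compatible: `k X k⁻¹ = Ad(k) X` -/
  equivariant : ∀ (k : C.Ktilde G) (X Y : lieAlg S G),
    (Y.1.1 : W →L[ℝ] W) = k.1.1.1 * X.1.1 * (k.1.1⁻¹).1 →
    ∀ v : V, rep k (lie (1 ⊗ₜ X) v) = lie (1 ⊗ₜ Y) (rep k v)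

namespace GKModule

variable {C : ComplexStructure S} {G G' : Subgroup (W →L[ℝ] W)ˣ}
  {V V' : Type*} [AddCommGroup V] [Module ℂ V] [AddCommGroup V'] [Module ℂ V']

/-- The module is nonzero and has no proper nonzero submodules. -/
def Irreducible (ρ : GKModule C G V) : Prop :=
  Nontrivial V ∧ ∀ P : Submodule ℂ V, (∀ X, ∀ v ∈ P, ρ.lie X v ∈ P) →
    (∀ k, ∀ v ∈ P, ρ.rep k v ∈ P) → P = ⊥ ∨ P = ⊤

/-- Every irreducible continuous finite-dimensional representation of `K̃` occurs in the module with
finite multiplicity. -/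
def Admissible (ρ : GKModule C G V) : Prop :=
  ∀ (n : ℕ) (τ : Representation ℂ (C.Ktilde G) (Fin n → ℂ)),
    (∀ v, Continuous fun k => τ k v) → τ.IsIrreducible →
    FiniteDimensional ℂ (Representation.IntertwiningMap τ ρ.rep)

/-- The annihilator of the module in `U(𝔤)`. -/
def annihilator (ρ : GKModule C G V) : Submodule ℂ (UniversalEnvelopingAlgebra ℂ (cLieAlg S G)) :=
  LinearMap.ker (UniversalEnvelopingAlgebra.lift ℂ ρ.lie).toLinearMap

/-- `ρ` and `ρ'` correspond to each other under Howe duality: the oscillator representation has an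
invariant subspace `ω₀` such that the quotient by `ω₀` is isomorphic to `ρ ⊗ ρ'` as a module for
`(𝔤, K̃)` and `(𝔤', K̃')`. -/
def HoweCorrespond [FiniteDimensional ℝ W] (ρ : GKModule C G V) (ρ' : GKModule C G' V') : Prop :=
  ∃ ω₀ : Submodule ℂ C.Fock,
    (∀ X, ∀ m ∈ ω₀, toWeyl S G (UniversalEnvelopingAlgebra.ι ℂ X) • m ∈ ω₀) ∧
    (∀ X, ∀ m ∈ ω₀, toWeyl S G' (UniversalEnvelopingAlgebra.ι ℂ X) • m ∈ ω₀) ∧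
    (∀ k : C.Ktilde G, ∀ m ∈ ω₀, C.fockRep ⟨k.1, k.2.1⟩ m ∈ ω₀) ∧
    (∀ k : C.Ktilde G', ∀ m ∈ ω₀, C.fockRep ⟨k.1, k.2.1⟩ m ∈ ω₀) ∧
    ∃ e : (C.Fock ⧸ ω₀) ≃ₗ[ℂ] V ⊗[ℂ] V',
      (∀ X m, e (ω₀.mkQ (toWeyl S G (UniversalEnvelopingAlgebra.ι ℂ X) • m))
        = (ρ.lie X).rTensor V' (e (ω₀.mkQ m))) ∧
      (∀ X m, e (ω₀.mkQ (toWeyl S G' (UniversalEnvelopingAlgebra.ι ℂ X) • m))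
        = (ρ'.lie X).lTensor V (e (ω₀.mkQ m))) ∧
      (∀ (k : C.Ktilde G) m, e (ω₀.mkQ (C.fockRep ⟨k.1, k.2.1⟩ m))
        = (ρ.rep k).rTensor V' (e (ω₀.mkQ m))) ∧
      (∀ (k : C.Ktilde G') m, e (ω₀.mkQ (C.fockRep ⟨k.1, k.2.1⟩ m))
        = (ρ'.rep k).lTensor V (e (ω₀.mkQ m)))

end GKModule

end Symplectic

end HoweDuality

end

open HoweDuality

/-! Let `p : ω → ρ ⊗ ρ'` be the quotient map that realizes the correspondence. It carries `L(a)` to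
`1 ⊗ ρ'(a)` and `R(u)` to `ρ(u) ⊗ 1`. For `a` in `I'`, `c` in `𝒲` and `m` in `ω`, the factor `c`
acts on `m` first, so `p(L(a) c m) = (1 ⊗ ρ'(a)) p(c m) = 0`. Thus the whole right ideal `L(I')𝒲`
maps `ω` into `ω₀`, although `ω₀` itself need not be stable under `𝒲`; this is why the transfer uses
the right ideal, with `L(I')` on the left.

If `u` lies in `θ(I')`, then `R(u)` lies in that ideal, so `ρ(u) ⊗ 1` vanishes on the image of `p`,
which is all of `ρ ⊗ ρ'`. As `ρ'` is nonzero, `ρ(u) = 0`.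

Two facts carry this. `comp_eq_comp_of_ι` passes from the Lie algebras, where the correspondence is
given, to their enveloping algebras. `apply_eq_zero_of_mem_transfer` is the computation with the
right ideal, for arbitrary algebras. -/

namespace UniversalEnvelopingAlgebra

attribute [local instance 100] LieRing.ofAssociativeRing

/-- If a linear map intertwines the generators of the enveloping algebra, acting on `M` through
`f` and on `N` through `g`, then it intertwines the whole enveloping algebra. -/
theorem comp_eq_comp_of_ι {R L M N : Type*} [CommRing R] [LieRing L] [LieAlgebra R L]
    [AddCommGroup M] [Module R M] [AddCommGroup N] [Module R N]
    (f : UniversalEnvelopingAlgebra R L →ₐ[R] Module.End R M)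
    (g : UniversalEnvelopingAlgebra R L →ₐ[R] Module.End R N) (p : M →ₗ[R] N)
    (h : ∀ X m, p (f (ι R X) m) = g (ι R X) (p m))
    (u : UniversalEnvelopingAlgebra R L) (m : M) : p (f u m) = g u (p m) := by
  -- The elements that `p` intertwines form a subalgebra: products by applying the property twice,
  -- scalars by linearity of `p`.
  let A : Subalgebra R (UniversalEnvelopingAlgebra R L) :=
    { carrier := {u | ∀ m, p (f u m) = g u (p m)}
      mul_mem' := fun {a b} ha hb m => by
        rw [map_mul, map_mul, Module.End.mul_apply, Module.End.mul_apply, ha, hb]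
      add_mem' := fun {a b} ha hb m => by
        rw [map_add, map_add, LinearMap.add_apply, LinearMap.add_apply, map_add, ha, hb]
      algebraMap_mem' := fun r m => by
        simp only [AlgHom.commutes, Module.algebraMap_end_apply, map_smul] }
  -- By `h` the generators lie in `A`, so `ι` corestricts to a Lie homomorphism into `A`.
  let F : L →ₗ⁅R⁆ A :=
    { toFun := fun X => ⟨ι R X, h X⟩
      map_add' := fun X Y => Subtype.ext (map_add (ι R) X Y)
      map_smul' := fun r X => Subtype.ext (map_smul (ι R) r X)
      map_lie' := fun {X Y} => Subtype.ext ((ι R).map_lie X Y) }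
  -- The extension of `F`, followed by the inclusion of `A`, fixes the generators and is therefore
  -- the identity. Hence every `u` is the value of an element of `A`.
  have key : A.val.comp (lift R F) = AlgHom.id R _ := by
    ext X
    simp only [LieHom.coe_comp, Function.comp_apply, AlgHom.coe_toLieHom, AlgHom.comp_apply,
      lift_ι_apply, AlgHom.id_apply]
    rfl
  have hu : ((lift R F u : A) : UniversalEnvelopingAlgebra R L) = u := DFunLike.congr_fun key u
  have hmem := (lift R F u).2
  rw [hu] at hmem
  exact hmem m

end UniversalEnvelopingAlgebra

/-- If a linear map `p` from an `A`-module `M` to `N` intertwines actions of `U'` and `U` on `M`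
through `L` and `R` with actions `g'` and `g` on `N`, then the transfer of a subspace annihilating
`N` annihilates the range of `p`. -/
theorem HoweDuality.apply_eq_zero_of_mem_transfer {K U U' A M N : Type*} [CommRing K] [Ring U]
    [Ring U'] [Ring A] [Algebra K U] [Algebra K U'] [Algebra K A] [AddCommGroup M] [Module A M]
    [AddCommGroup N] [Module K N] {L : U' →ₐ[K] A} {R : U →ₐ[K] A} (p : M →+ N)
    (g : U →ₐ[K] Module.End K N) (g' : U' →ₐ[K] Module.End K N)
    (h : ∀ u m, p (R u • m) = g u (p m)) (h' : ∀ u m, p (L u • m) = g' u (p m))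
    {I' : Submodule K U'} (hI' : ∀ u ∈ I', g' u = 0) {u : U} (hu : u ∈ transfer L R I') (m : M) :
    g u (p m) = 0 := by
  have key : ∀ a ∈ I'.map L.toLinearMap * (⊤ : Submodule K A), p (a • m) = 0 := by
    intro a ha
    induction ha using Submodule.mul_induction_on' with
    | mem_mul_mem b hb c _ =>
      obtain ⟨v, hv, rfl⟩ := hb
      -- `h'` is applied at the vector `c • m`. Nothing has to be known about `p (c • m)`, since `g'
      -- v` is zero on all of `N`.
      rw [mul_smul, AlgHom.toLinearMap_apply, h', hI' v hv, LinearMap.zero_apply]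
    | add b _ c _ hb hc => rw [add_smul, map_add, hb, hc, add_zero]
  -- The transfer is a preimage under `R`, so `hu` says exactly that `R u` lies in the right ideal
  -- treated in `key`.
  rw [← h]
  exact key _ hu

open HoweDuality
theorem theorem1p1 {W : Type*} [NormedAddCommGroup W] [NormedSpace ℝ W] [FiniteDimensional ℝ W]
    (S : SymplecticForm W) (G G' : Subgroup (W →L[ℝ] W)ˣ) (hG : IsIrreducibleDualPair S G G')
    (C : ComplexStructure S) (hC : C.CartanStable G) (hC' : C.CartanStable G')
    {V V' : Type*} [AddCommGroup V] [Module ℂ V] [AddCommGroup V'] [Module ℂ V']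
    (ρ : GKModule C G V) (ρ' : GKModule C G' V')
    (hρ : ρ.Irreducible) (hρa : ρ.Admissible) (hρ' : ρ'.Irreducible) (hρa' : ρ'.Admissible)
    (h : ρ.HoweCorrespond ρ') :
    transfer (toWeyl S G') (toWeyl S G) ρ'.annihilator ≤ ρ.annihilator := by
  obtain ⟨ω₀, -, -, -, -, e, he, he', -, -⟩ := h
  have : Nontrivial V' := hρ'.1
  let p : C.Fock →ₗ[ℂ] TensorProduct ℂ V V' := e.toLinearMap ∘ₗ ω₀.mkQ
  -- The actions `u ↦ ρ(u) ⊗ 1` and `u ↦ 1 ⊗ ρ'(u)` on `V ⊗ V'`, as algebra homomorphisms.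
  let g := (Module.End.rTensorAlgHom ℂ V V').comp (UniversalEnvelopingAlgebra.lift ℂ ρ.lie)
  let g' := (Module.End.lTensorAlgHom ℂ V' V).comp (UniversalEnvelopingAlgebra.lift ℂ ρ'.lie)
  have h : ∀ u m, p (toWeyl S G u • m) = g u (p m) :=
    UniversalEnvelopingAlgebra.comp_eq_comp_of_ι
      -- Left multiplication turns the Fock space into a representation of `U(𝔤)` through `R`; on
      -- generators the intertwining is `he`.
      ((Algebra.lsmul ℂ ℂ C.Fock).comp (toWeyl S G)) g p fun X m => by
        change _ = (UniversalEnvelopingAlgebra.lift ℂ ρ.lie _).rTensor V' (p m)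
        rw [UniversalEnvelopingAlgebra.lift_ι_apply]
        exact he X m
  have h' : ∀ u m, p (toWeyl S G' u • m) = g' u (p m) :=
    UniversalEnvelopingAlgebra.comp_eq_comp_of_ι
      ((Algebra.lsmul ℂ ℂ C.Fock).comp (toWeyl S G')) g' p fun X m => by
        change _ = (UniversalEnvelopingAlgebra.lift ℂ ρ'.lie _).lTensor V (p m)
        rw [UniversalEnvelopingAlgebra.lift_ι_apply]
        exact he' X m
  intro u hu
  have hp : Function.Surjective p := e.surjective.comp ω₀.mkQ_surjective
  have hI' : ∀ v ∈ ρ'.annihilator, g' v = 0 := fun v hv => by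
    have hv : UniversalEnvelopingAlgebra.lift ℂ ρ'.lie v = 0 := hv
    rw [AlgHom.comp_apply, hv, map_zero]
  -- Since `p` is surjective, vanishing on its range is vanishing on `V ⊗ V'`.
  have hgu : (UniversalEnvelopingAlgebra.lift ℂ ρ.lie u).rTensor V' = 0 :=
    LinearMap.ext fun x => by
      obtain ⟨m, rfl⟩ := hp x
      exact apply_eq_zero_of_mem_transfer p.toAddMonoidHom g g' h h' hI' hu m
  -- A nonzero vector space is faithfully flat, so tensoring with `V'` detects whether a linear map
  -- is zero.
  exact (Module.FaithfullyFlat.zero_iff_rTensor_zero ℂ V' _).2 hgu
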